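/- Let $\phi:\mathbb R\to[0,+\infty]$ be convex and lower semicontinuous, with $\phi(x)=+\infty$ for $x<0$ and $\phi\not\equiv+\infty$ (this holds in particular under the usual normalization $\phi(1)=0$ of a $\phi$-divergence, and also if $\phi(0)=1$). Let $\tau\ge 0$ and $B>0$. For a probability space $(\Omega,\mathcal F,P)$ let $\mathfrak D$ be the set of probability density functions with respect to $P$. For a measurable $X:\Omega\to[0,B]$ put $$\mathcal R(X)=\sup\Big\{\int_\Omega X\zeta\,dP:\ \zeta\in\mathfrak D,\ \int_\Omega\phi(\zeta)\,dP\le\tau\Big\}\in[-\infty,\infty),\qquad \sup\emptyset=-\infty .$$ For $L>0$ let $\phi_L=\phi+\delta_{[0,L]}$, where $\delta_{[0,L]}$ is $0$ on $[0,L]$ and $+\infty$ elsewhere. For $\lambda>0$ and $\mu\in\mathbb R$ let $$f_{(\lambda,\mu)}(x)=f^{L}_{(\lambda,\mu)}(x)=\lambda\tau+\mu+(\lambda\phi_L)^*(x-\mu),\qquad \mathcal R_L(X)=\inf_{\lambda>0,\ \mu\in\mathbb R}\mathbb E_P\big[f_{(\lambda,\mu)}(X)\big],$$ where $g^*(y)=\sup_{z\in\mathbb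 R}\{zy-g(z)\}$. Then, for every probability space $(\Omega,\mathcal F,P)$, every measurable $X:\Omega\to[0,B]$ and every $\epsilon>0$, there are $L=L(\epsilon)>0$ and $M=M(\epsilon)>0$ such that the following hold. (a) $\mathcal R(X)\ \ge\ \mathcal R_{L}(X)\ \ge\ \mathcal R(X)-\epsilon$. (b) For this $L$, every $f_{(\lambda,\mu)}$ with $\lambda>0$, $\mu\in\mathbb R$ is real-valued and satisfies $$f_{(\lambda,\mu)}(\alpha x)=\alpha f_{(\lambda/\alpha,\,\mu/\alpha)}(x)\quad\text{for all }\alpha>0,\ x\in\mathbb R,$$ $$|f_{(\lambda,\mu)}(x)-f_{(\lambda,\mu)}(x')|\le M|x-x'|\quad\text{for all }x,x'\in\mathbb R .$$ (c) If in addition $\lim_{x\to\infty}\phi(x)/x=\infty$, then $L(\epsilon)$ and $M(\epsilon)$ can be chosen independently of $X$ and of $(\Omega,\mathcal F,P)$: they depend only on $\phi,\tau,B,\epsilon$. -/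

import Mathlib

open MeasureTheory Filter Topology
open scoped ENNReal NNReal

universe u

namespace PhiDRO

noncomputable section

/-- The indicator `δ_A` of convex analysis: `0` on `A` and `+∞` off `A`. -/
def convexIndicator (A : Set ℝ) (x : ℝ) : ℝ≥0∞ :=
  open Classical in if x ∈ A then 0 else ⊤

/-- The truncated divergence function `φ_L = φ + δ_{[0, L]}`. -/
def truncate (φ : ℝ → ℝ≥0∞) (L : ℝ) (x : ℝ) : ℝ≥0∞ :=
  φ x + convexIndicator (Set.Icc 0 L) x

/-- The convex conjugate `g^*(y) = sup_z (z y - g(z))` of an extended-real-valued function. -/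
def conjugate (g : ℝ → EReal) (y : ℝ) : EReal :=
  ⨆ z : ℝ, (((z * y : ℝ) : EReal) - g z)

variable {Ω : Type u} [MeasurableSpace Ω]

/-- The set `𝔇` of probability density functions with respect to `P`. -/
def densities (P : Measure Ω) : Set (Ω → ℝ) :=
  {ζ | Measurable ζ ∧ (∀ ω, 0 ≤ ζ ω) ∧ Integrable ζ P ∧ ∫ ω, ζ ω ∂P = 1}

/-- The ambiguity set `𝔐 = {ζ ∈ 𝔇 : ∫ φ(ζ) dP ≤ τ}`. -/
def ambiguitySet (P : Measure Ω) (φ : ℝ → ℝ≥0∞) (τ : ℝ) : Set (Ω → ℝ) :=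
  {ζ | ζ ∈ densities P ∧ ∫⁻ ω, φ (ζ ω) ∂P ≤ ENNReal.ofReal τ}

/-- The distributionally robust functional `ℛ(X) = sup_{ζ ∈ 𝔐} ∫ X ζ dP`
(equal to `-∞` if the ambiguity set is empty). -/
def robustRisk (P : Measure Ω) (φ : ℝ → ℝ≥0∞) (τ : ℝ) (X : Ω → ℝ) : EReal :=
  ⨆ ζ ∈ ambiguitySet P φ τ, ((∫ ω, X ω * ζ ω ∂P : ℝ) : EReal)

/-- The parameter set `{(λ, μ) : λ > 0, μ ∈ ℝ}`. -/
def dualParams : Set (ℝ × ℝ) := {θ | 0 < θ.1}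

/-- The dual integrand `f_{(λ, μ)}(x) = λ τ + μ + (λ φ)^*(x - μ)`, where `θ = (λ, μ)`. -/
def dualIntegrand (φ : ℝ → ℝ≥0∞) (τ : ℝ) (θ : ℝ × ℝ) (x : ℝ) : EReal :=
  ((θ.1 * τ + θ.2 : ℝ) : EReal)
    + conjugate (fun z => (θ.1 : EReal) * ((φ z : ℝ≥0∞) : EReal)) (x - θ.2)

/-- `inf_{λ > 0, μ ∈ ℝ} E_P [f_{(λ, μ)}(X)]`. The expectation is that of a real random variable: it
is used where the dual integrand is real-valued and Lipschitz, and `X` is bounded and measurable. -/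
def dualRisk (P : Measure Ω) (φ : ℝ → ℝ≥0∞) (τ : ℝ) (X : Ω → ℝ) : EReal :=
  ⨅ θ ∈ dualParams, ((∫ ω, (dualIntegrand φ τ θ (X ω)).toReal ∂P : ℝ) : EReal)

/-- The family `(f_θ)`, `θ ∈ Θ`, consists of real-valued functions on `ℝ`, satisfies
`f_θ(α x) = α f_{θ/α}(x)` for all `α > 0`, and every `f_θ` is `M`-Lipschitz. -/
structure ScalingLipschitz (Θ : Set (ℝ × ℝ)) (f : ℝ × ℝ → ℝ → EReal) (M : ℝ) : Prop where
  finite : ∀ θ ∈ Θ, ∀ x, f θ x ≠ ⊥ ∧ f θ x ≠ ⊤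
  scaling : ∀ α : ℝ, 0 < α → ∀ θ ∈ Θ, ∀ x,
    f θ (α * x) = (α : EReal) * f (α⁻¹ • θ) x
  lipschitz : ∀ θ ∈ Θ, ∀ x x', |(f θ x).toReal - (f θ x').toReal| ≤ M * |x - x'|

end

end PhiDRO

/-! Truncation makes the dual regular: every affine piece of `(λ φ_L)^*` has slope in `[0, L]`, so
the conjugate is real-valued and `L`-Lipschitz, and `M = L` works.

Upper bound for the dual (`dualRisk_truncate_le_robustRisk`): rounding `X` to a grid turns the
problem into a finite-dimensional one. There the attainable triples (mass, divergence, payoff) form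
a convex set, closed because densities range over a compact box, so Hahn–Banach separation yields
the multipliers. The rounding error is absorbed by the Lipschitz bound. No Slater condition is
needed, since the target value exceeds every feasible payoff strictly.

Lower bound: Fenchel–Young gives weak duality for densities bounded by `L`, so it remains to replace
a feasible density by a bounded one at small cost (`exists_bounded_mem_ambiguitySet`). Mixing it
with its own weighted average preserves mass and, by Jensen, does not raise the divergence. The loss
is at most `B` times the tail plus a small term. A single near-optimal density has a small tail;
superlinear growth of `φ` makes all tails uniformly small, hence `L` uniform. -/

namespace PhiDRO

/-- The effective domain of the truncated divergence function. -/
def truncDom (φ : ℝ → ℝ≥0∞) (L : ℝ) : Set ℝ := {z | z ∈ Set.Icc 0 L ∧ φ z ≠ ⊤}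

/-- The real-valued conjugate `y ↦ (λ φ_L)^*(y)`. -/
noncomputable def truncConj (φ : ℝ → ℝ≥0∞) (L lam y : ℝ) : ℝ :=
  sSup ((fun z => z * y - lam * (φ z).toReal) '' truncDom φ L)

/-! ### The truncated conjugate: finiteness, Lipschitz bound, scaling. -/

section Conjugate

variable {φ : ℝ → ℝ≥0∞} {L lam : ℝ}

theorem bddAbove_truncConj (hlam : 0 ≤ lam) (y : ℝ) :
    BddAbove ((fun z => z * y - lam * (φ z).toReal) '' truncDom φ L) := by
  refine ⟨L * |y|, ?_⟩
  rintro _ ⟨z, ⟨⟨hz0, hzL⟩, -⟩, rfl⟩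
  have h1 : z * y ≤ L * |y| :=
    (mul_le_mul_of_nonneg_left (le_abs_self y) hz0).trans
      (mul_le_mul_of_nonneg_right hzL (abs_nonneg y))
  have h2 : 0 ≤ lam * (φ z).toReal := mul_nonneg hlam ENNReal.toReal_nonneg
  simp only
  linarith

theorem le_truncConj (hlam : 0 ≤ lam) (y : ℝ) {z : ℝ} (hz : z ∈ truncDom φ L) :
    z * y - lam * (φ z).toReal ≤ truncConj φ L lam y :=
  le_csSup (bddAbove_truncConj hlam y) ⟨z, hz, rfl⟩

theorem truncConj_le (hne : (truncDom φ L).Nonempty) {y c : ℝ}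
    (h : ∀ z ∈ truncDom φ L, z * y - lam * (φ z).toReal ≤ c) : truncConj φ L lam y ≤ c := by
  refine csSup_le (hne.image _) ?_
  rintro _ ⟨z, hz, rfl⟩
  exact h z hz

theorem truncConj_le_add (hne : (truncDom φ L).Nonempty) (hlam : 0 ≤ lam) (y y' : ℝ) :
    truncConj φ L lam y ≤ truncConj φ L lam y' + L * |y - y'| := by
  refine truncConj_le hne fun z hz => ?_
  have h1 := le_truncConj hlam y' hz
  have h2 : z * (y - y') ≤ L * |y - y'| :=
    (mul_le_mul_of_nonneg_left (le_abs_self _) hz.1.1).trans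
      (mul_le_mul_of_nonneg_right hz.1.2 (abs_nonneg _))
  linarith

theorem abs_truncConj_sub_le (hne : (truncDom φ L).Nonempty) (hlam : 0 ≤ lam) (y y' : ℝ) :
    |truncConj φ L lam y - truncConj φ L lam y'| ≤ L * |y - y'| := by
  have h1 := truncConj_le_add hne hlam y y'
  have h2 := truncConj_le_add hne hlam y' y
  rw [abs_sub_comm] at h2
  rw [abs_le]
  constructor <;> linarith

theorem continuous_truncConj (hne : (truncDom φ L).Nonempty) (hlam : 0 ≤ lam) :
    Continuous (truncConj φ L lam) := by
  obtain ⟨z, hz⟩ := hne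
  have hL : 0 ≤ L := hz.1.1.trans hz.1.2
  refine (LipschitzWith.of_dist_le_mul (K := L.toNNReal) fun y y' => ?_).continuous
  rw [Real.dist_eq, Real.dist_eq, Real.coe_toNNReal _ hL]
  exact abs_truncConj_sub_le ⟨z, hz⟩ hlam y y'

/-- Holds because `φ ≥ 0`. It allows a zero multiplier to be raised to a positive one in
`finite_duality`. -/
theorem truncConj_anti (hne : (truncDom φ L).Nonempty) {lam' : ℝ} (hlam : 0 ≤ lam)
    (h : lam ≤ lam') (y : ℝ) : truncConj φ L lam' y ≤ truncConj φ L lam y := by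
  refine truncConj_le hne fun z hz => ?_
  have h1 := le_truncConj hlam y hz
  have h2 := mul_le_mul_of_nonneg_right h (ENNReal.toReal_nonneg (a := φ z))
  linarith

theorem truncConj_mul (hne : (truncDom φ L).Nonempty) (hlam : 0 ≤ lam) {α : ℝ} (hα : 0 < α)
    (y : ℝ) : truncConj φ L lam (α * y) = α * truncConj φ L (α⁻¹ * lam) y := by
  have hα' : 0 ≤ α⁻¹ * lam := by positivity
  apply le_antisymm
  · refine truncConj_le hne fun z hz => ?_
    have h1 := mul_le_mul_of_nonneg_left (le_truncConj hα' y hz) hα.le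
    have h2 : α * (z * y - α⁻¹ * lam * (φ z).toReal) = z * (α * y) - lam * (φ z).toReal := by
      field_simp
    linarith
  · rw [← le_div_iff₀' hα]
    refine truncConj_le hne fun z hz => ?_
    rw [le_div_iff₀' hα]
    have h1 := le_truncConj hlam (α * y) hz
    have h2 : α * (z * y - α⁻¹ * lam * (φ z).toReal) = z * (α * y) - lam * (φ z).toReal := by
      field_simp
    linarith

theorem truncate_of_mem {z : ℝ} (hz : z ∈ truncDom φ L) : truncate φ L z = φ z := by
  rw [truncate, convexIndicator, if_pos hz.1, add_zero]

theorem truncate_of_notMem {z : ℝ} (hz : z ∉ truncDom φ L) : truncate φ L z = ⊤ := by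
  by_cases h : z ∈ Set.Icc 0 L
  · have : φ z = ⊤ := by
      by_contra h'
      exact hz ⟨h, h'⟩
    simp [truncate, this]
  · simp only [truncate, convexIndicator, if_neg h, add_top]

/-- Points outside `truncDom` contribute `⊥` because `lam > 0`; with `lam = 0` the product `0 * ⊤`
would be `0` and they would count. -/
theorem conjugate_truncate (hne : (truncDom φ L).Nonempty) (hlam : 0 < lam) (y : ℝ) :
    conjugate (fun z => (lam : EReal) * ((truncate φ L z : ℝ≥0∞) : EReal)) y
      = (truncConj φ L lam y : EReal) := by
  have key : ∀ z ∈ truncDom φ L, ((z * y : ℝ) : EReal)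
      - (lam : EReal) * ((truncate φ L z : ℝ≥0∞) : EReal)
      = ((z * y - lam * (φ z).toReal : ℝ) : EReal) := by
    intro z hz
    rw [truncate_of_mem hz]
    have : ((φ z : ℝ≥0∞) : EReal) = (((φ z).toReal : ℝ) : EReal) :=
      (EReal.coe_ennreal_toReal hz.2).symm
    rw [this]
    norm_cast
  apply le_antisymm
  · refine iSup_le fun z => ?_
    by_cases hz : z ∈ truncDom φ L
    · refine (key z hz).trans_le ?_
      exact EReal.coe_le_coe_iff.2 (le_truncConj hlam.le y hz)
    · simp only
      rw [truncate_of_notMem hz, EReal.coe_ennreal_top, EReal.coe_mul_top_of_pos hlam,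
        EReal.sub_top]
      exact bot_le
  · have hle (z : ℝ) := le_iSup (fun z => ((z * y : ℝ) : EReal)
      - (lam : EReal) * ((truncate φ L z : ℝ≥0∞) : EReal)) z
    refine le_of_forall_lt fun c hc => ?_
    induction c with
    | bot =>
      obtain ⟨z, hz⟩ := hne
      exact lt_of_lt_of_le (EReal.bot_lt_coe _) ((key z hz).symm.trans_le (hle z))
    | top => exact absurd hc (by simp)
    | coe c =>
      obtain ⟨_, ⟨z, hz, rfl⟩, hcz⟩ := exists_lt_of_lt_csSup (hne.image _)
        (EReal.coe_lt_coe_iff.1 hc)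
      exact lt_of_lt_of_le (EReal.coe_lt_coe_iff.2 hcz) ((key z hz).symm.trans_le (hle z))

theorem dualIntegrand_truncate (hne : (truncDom φ L).Nonempty) (τ : ℝ) {θ : ℝ × ℝ}
    (hθ : θ ∈ dualParams) (x : ℝ) :
    dualIntegrand (truncate φ L) τ θ x
      = ((θ.1 * τ + θ.2 + truncConj φ L θ.1 (x - θ.2) : ℝ) : EReal) := by
  rw [dualIntegrand, conjugate_truncate hne hθ, ← EReal.coe_add]

theorem scalingLipschitz_dualIntegrand_truncate (hne : (truncDom φ L).Nonempty) (τ : ℝ) :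
    ScalingLipschitz dualParams (dualIntegrand (truncate φ L) τ) L where
  finite θ hθ x := by
    rw [dualIntegrand_truncate hne τ hθ]
    exact ⟨EReal.coe_ne_bot _, EReal.coe_ne_top _⟩
  scaling α hα θ hθ x := by
    have hθ' : α⁻¹ • θ ∈ dualParams := by
      have h : 0 < θ.1 := hθ
      change 0 < α⁻¹ * θ.1
      positivity
    rw [dualIntegrand_truncate hne τ hθ, dualIntegrand_truncate hne τ hθ', ← EReal.coe_mul]
    congr 1
    have h1 : α * x - θ.2 = α * (x - α⁻¹ * θ.2) := by field_simp
    rw [h1, truncConj_mul hne (le_of_lt hθ) hα]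
    simp only [Prod.smul_fst, Prod.smul_snd, smul_eq_mul]
    field_simp
  lipschitz θ hθ x x' := by
    rw [dualIntegrand_truncate hne τ hθ, dualIntegrand_truncate hne τ hθ, EReal.toReal_coe,
      EReal.toReal_coe, add_sub_add_left_eq_sub]
    simpa using abs_truncConj_sub_le hne (le_of_lt hθ) (x - θ.2) (x' - θ.2)

end Conjugate

/-! ### Convexity and closedness of epigraphs. -/

section Epigraph

/-- The real epigraph of a `[0, ∞]`-valued function. -/
def epigraph {E : Type*} (Φ : E → ℝ≥0∞) : Set (E × ℝ) := {p | 0 ≤ p.2 ∧ Φ p.1 ≤ ENNReal.ofReal p.2}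

theorem convex_epigraph {E : Type*} [AddCommGroup E] [Module ℝ E] {Φ : E → ℝ≥0∞} (h : ∀ x y : E, ∀ a b : ℝ, 0 ≤ a → 0 ≤ b → a + b = 1 →
    Φ (a • x + b • y) ≤ ENNReal.ofReal a * Φ x + ENNReal.ofReal b * Φ y) :
    Convex ℝ (epigraph Φ) := by
  rintro ⟨x, r⟩ ⟨hr, hx⟩ ⟨y, s⟩ ⟨hs, hy⟩ a b ha hb hab
  simp only at hr hx hs hy
  refine ⟨?_, ?_⟩
  · change 0 ≤ a * r + b * s
    positivity
  · change Φ (a • x + b • y) ≤ ENNReal.ofReal (a * r + b * s)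
    rw [ENNReal.ofReal_add (by positivity) (by positivity), ENNReal.ofReal_mul ha,
      ENNReal.ofReal_mul hb]
    refine (h x y a b ha hb hab).trans ?_
    gcongr

theorem isClosed_epigraph {E : Type*} [TopologicalSpace E] {Φ : E → ℝ≥0∞}
    (h : LowerSemicontinuous Φ) :
    IsClosed (epigraph Φ) := by
  refine (isClosed_le continuous_const continuous_snd).inter ?_
  exact h.isClosed_epigraph.preimage
    (continuous_fst.prodMk (ENNReal.continuous_ofReal.comp continuous_snd))

end Epigraph

theorem apply_combination_le {φ : ℝ → ℝ≥0∞} (hφ : ConvexOn ℝ≥0 Set.univ φ) (x y a b : ℝ)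
    (ha : 0 ≤ a) (hb : 0 ≤ b) (hab : a + b = 1) :
    φ (a • x + b • y) ≤ ENNReal.ofReal a * φ x + ENNReal.ofReal b * φ y := by
  have h := hφ.2 (Set.mem_univ x) (Set.mem_univ y) (zero_le (a := a.toNNReal))
    (zero_le (a := b.toNNReal))
    (by rw [← Real.toNNReal_add ha hb, hab, Real.toNNReal_one])
  simpa [NNReal.smul_def, ENNReal.smul_def, ENNReal.ofReal, ha, hb] using h

/-! ### Lagrange duality on a finite probability space. -/

section FiniteDuality

variable {ι : Type*} [Fintype ι] {φ : ℝ → ℝ≥0∞}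

/-- The expected divergence of a finitely supported density. -/
noncomputable def sumDiv (φ : ℝ → ℝ≥0∞) (p z : ι → ℝ) : ℝ≥0∞ :=
  ∑ i, ENNReal.ofReal (p i) * φ (z i)

theorem sumDiv_combination_le (hφ : ConvexOn ℝ≥0 Set.univ φ) (p : ι → ℝ) (x y : ι → ℝ) (a b : ℝ)
    (ha : 0 ≤ a) (hb : 0 ≤ b) (hab : a + b = 1) :
    sumDiv φ p (a • x + b • y)
      ≤ ENNReal.ofReal a * sumDiv φ p x + ENNReal.ofReal b * sumDiv φ p y := by
  simp only [sumDiv, Finset.mul_sum, ← Finset.sum_add_distrib]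
  refine Finset.sum_le_sum fun i _ => ?_
  calc ENNReal.ofReal (p i) * φ ((a • x + b • y) i)
      ≤ ENNReal.ofReal (p i) * (ENNReal.ofReal a * φ (x i) + ENNReal.ofReal b * φ (y i)) := by
        gcongr
        exact apply_combination_le hφ (x i) (y i) a b ha hb hab
    _ = _ := by ring

theorem lowerSemicontinuous_sumDiv (hφ : LowerSemicontinuous φ) (p : ι → ℝ) :
    LowerSemicontinuous (sumDiv φ p) := by
  refine lowerSemicontinuous_sum fun i _ => ?_
  have h : LowerSemicontinuous fun z : ι → ℝ => φ (z i) := hφ.comp (continuous_apply i)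
  exact (ENNReal.continuous_const_mul ENNReal.ofReal_ne_top).comp_lowerSemicontinuous h
    fun _ _ hab => mul_le_mul_right hab _

theorem sumDiv_eq_ofReal {p z : ι → ℝ} (hp : ∀ i, 0 ≤ p i) (hz : ∀ i, φ (z i) ≠ ⊤) :
    sumDiv φ p z = ENNReal.ofReal (∑ i, p i * (φ (z i)).toReal) := by
  rw [ENNReal.ofReal_sum_of_nonneg fun i _ => mul_nonneg (hp i) ENNReal.toReal_nonneg]
  refine Finset.sum_congr rfl fun i _ => ?_
  rw [ENNReal.ofReal_mul (hp i), ENNReal.ofReal_toReal (hz i)]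

/-- Triples (mass, divergence bound, payoff bound) attained by densities with values in
`[0, L]`, together with the density. -/
def attainableGraph (φ : ℝ → ℝ≥0∞) (L : ℝ) (p x : ι → ℝ) : Set ((ι → ℝ) × ℝ × ℝ × ℝ) :=
  {q | q.1 ∈ Set.Icc (0 : ι → ℝ) (fun _ => L) ∧ ∑ i, p i * q.1 i = q.2.1 ∧
    (q.1, q.2.2.1) ∈ epigraph (sumDiv φ p) ∧ q.2.2.2 ≤ ∑ i, p i * x i * q.1 i}

theorem convex_attainableGraph (hφ : ConvexOn ℝ≥0 Set.univ φ) (L : ℝ) (p x : ι → ℝ) :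
    Convex ℝ (attainableGraph φ L p x) := by
  rintro ⟨z, a, b, d⟩ ⟨h1, h2, h3, h4⟩ ⟨z', a', b', d'⟩ ⟨h1', h2', h3', h4'⟩ s t hs ht hst
  simp only at h1 h2 h3 h4 h1' h2' h3' h4'
  have hlin : ∀ c : ι → ℝ, ∑ i, c i * (s * z i + t * z' i)
      = s * ∑ i, c i * z i + t * ∑ i, c i * z' i := by
    intro c
    rw [Finset.mul_sum, Finset.mul_sum, ← Finset.sum_add_distrib]
    exact Finset.sum_congr rfl fun i _ => by ring
  refine ⟨convex_Icc _ _ h1 h1' hs ht hst, ?_,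
    convex_epigraph (sumDiv_combination_le hφ p) h3 h3' hs ht hst, ?_⟩
  · change ∑ i, p i * (s * z i + t * z' i) = s * a + t * a'
    rw [hlin, h2, h2']
  · change s * d + t * d' ≤ ∑ i, p i * x i * (s * z i + t * z' i)
    rw [hlin]
    gcongr

theorem isClosed_attainableGraph (hφ : LowerSemicontinuous φ) (L : ℝ) (p x : ι → ℝ) :
    IsClosed (attainableGraph φ L p x) := by
  refine (isClosed_Icc.preimage continuous_fst).inter (IsClosed.inter ?_ (IsClosed.inter ?_ ?_))
  · exact isClosed_eq (f := fun q : (ι → ℝ) × ℝ × ℝ × ℝ => ∑ i, p i * q.1 i)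
      (g := fun q => q.2.1) (by fun_prop) (by fun_prop)
  · exact (isClosed_epigraph (lowerSemicontinuous_sumDiv hφ p)).preimage
      (f := fun q : (ι → ℝ) × ℝ × ℝ × ℝ => (q.1, q.2.2.1)) (by fun_prop)
  · exact isClosed_le (f := fun q : (ι → ℝ) × ℝ × ℝ × ℝ => q.2.2.2)
      (g := fun q => ∑ i, p i * x i * q.1 i) (by fun_prop) (by fun_prop)

/-- The density coordinate lies in a compact box, and projection along a compact factor is a closed
map. -/
theorem isClosed_snd_image_attainableGraph (hφ : LowerSemicontinuous φ) (L : ℝ) (p x : ι → ℝ) :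
    IsClosed (Prod.snd '' attainableGraph φ L p x) := by
  have hK : CompactSpace (Set.Icc (0 : ι → ℝ) (fun _ => L)) :=
    isCompact_iff_compactSpace.1 isCompact_Icc
  have h : Prod.snd '' attainableGraph φ L p x
      = Prod.snd '' (Prod.map Subtype.val id ⁻¹' attainableGraph φ L p x :
        Set (Set.Icc (0 : ι → ℝ) (fun _ => L) × (ℝ × ℝ × ℝ))) := by
    ext w
    constructor
    · rintro ⟨⟨z, w⟩, hq, rfl⟩
      exact ⟨(⟨z, hq.1⟩, w), hq, rfl⟩
    · rintro ⟨⟨z, w⟩, hq, rfl⟩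
      exact ⟨(z, w), hq, rfl⟩
  rw [h]
  exact isClosedMap_snd_of_compactSpace _ ((isClosed_attainableGraph hφ L p x).preimage
    (continuous_subtype_val.prodMap continuous_id))

/-- A hyperplane with normal `(P, Q, R)` separates `(1, τ, v)` from the attainable triples; dividing
by `R` gives the multipliers when `R > 0`. -/
theorem exists_multipliers (hφc : ConvexOn ℝ≥0 Set.univ φ) (hφl : LowerSemicontinuous φ)
    {L τ v : ℝ} (hne : (truncDom φ L).Nonempty) {p x : ι → ℝ} (hp : ∀ i, 0 ≤ p i)
    (h : ∀ z : ι → ℝ, (∀ i, z i ∈ Set.Icc 0 L) → ∑ i, p i * z i = 1 →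
      sumDiv φ p z ≤ ENNReal.ofReal τ → ∑ i, p i * x i * z i < v) :
    ∃ lam μ : ℝ, 0 ≤ lam ∧ ∀ z : ι → ℝ, (∀ i, z i ∈ truncDom φ L) →
      ∑ i, p i * x i * z i - lam * ∑ i, p i * (φ (z i)).toReal - μ * ∑ i, p i * z i
        ≤ v - lam * τ - μ := by
  have hnot : ((1, τ, v) : ℝ × ℝ × ℝ) ∉ Prod.snd '' attainableGraph φ L p x := by
    rintro ⟨⟨z, w⟩, ⟨h1, h2, h3, h4⟩, rfl⟩
    exact absurd (h z (fun i => ⟨h1.1 i, h1.2 i⟩) h2 h3.2) (not_lt.2 h4)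
  obtain ⟨f, u, hf, hu⟩ := geometric_hahn_banach_closed_point
    ((convex_attainableGraph hφc L p x).linear_image (LinearMap.snd ℝ _ _))
    (isClosed_snd_image_attainableGraph hφl L p x) hnot
  set P := f (1, 0, 0)
  set Q := f (0, 1, 0)
  set R := f (0, 0, 1)
  have hlin : ∀ a b d : ℝ, f (a, b, d) = P * a + Q * b + R * d := by
    intro a b d
    have : ((a, b, d) : ℝ × ℝ × ℝ)
        = a • ((1, 0, 0) : ℝ × ℝ × ℝ) + b • ((0, 1, 0) : ℝ × ℝ × ℝ)
          + d • ((0, 0, 1) : ℝ × ℝ × ℝ) := by simp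
    rw [this, map_add, map_add, map_smul, map_smul, map_smul]
    simp only [smul_eq_mul, P, Q, R]
    ring
  rw [hlin] at hu
  -- The slacks `s` and `t` express that divergence bounds may be raised and payoff bounds lowered;
  -- sending them to infinity fixes the signs of `Q` and `R`.
  have hsep : ∀ z : ι → ℝ, (∀ i, z i ∈ truncDom φ L) → ∀ s ≥ (0 : ℝ), ∀ t ≥ (0 : ℝ),
      P * (∑ i, p i * z i) + Q * (∑ i, p i * (φ (z i)).toReal + s)
        + R * (∑ i, p i * x i * z i - t) < u := by
    intro z hz s hs t ht
    rw [← hlin]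
    have h0 : 0 ≤ ∑ i, p i * (φ (z i)).toReal :=
      Finset.sum_nonneg fun i _ => mul_nonneg (hp i) ENNReal.toReal_nonneg
    refine hf _ ⟨(z, _), ⟨⟨fun i => (hz i).1.1, fun i => (hz i).1.2⟩, rfl,
      ⟨?_, ?_⟩, ?_⟩, rfl⟩
    · simp only; linarith
    · simp only
      rw [sumDiv_eq_ofReal hp fun i => (hz i).2]
      exact ENNReal.ofReal_le_ofReal (by linarith)
    · simp only; linarith
  obtain ⟨z0, hz0⟩ := hne
  have hQ : Q ≤ 0 := by
    by_contra! hQ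
    have key := fun s hs => hsep (fun _ => z0) (fun _ => hz0) s hs 0 le_rfl
    set A := P * (∑ i, p i * z0) + Q * (∑ i, p i * (φ z0).toReal)
      + R * (∑ i, p i * x i * z0 - 0) with hA
    have h1 := key (|u - A| / Q) (by positivity)
    have h2 : Q * (|u - A| / Q) = |u - A| := by field_simp
    have h3 := le_abs_self (u - A)
    rw [mul_add] at h1
    linarith
  have hR : 0 ≤ R := by
    by_contra! hR
    have key := fun s hs => hsep (fun _ => z0) (fun _ => hz0) 0 le_rfl s hs
    set A := P * (∑ i, p i * z0) + Q * (∑ i, p i * (φ z0).toReal + 0)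
      + R * (∑ i, p i * x i * z0) with hA
    have h1 := key (|u - A| / (-R)) (div_nonneg (abs_nonneg _) (by linarith))
    have h2 : R * (|u - A| / (-R)) = -|u - A| := by
      have : R ≠ 0 := hR.ne
      field_simp
    have h3 := le_abs_self (u - A)
    rw [mul_sub] at h1
    linarith
  have hsep0 := fun z hz => hsep z hz 0 le_rfl 0 le_rfl
  simp only [add_zero, sub_zero] at hsep0
  -- If `R = 0` the hyperplane ignores the payoff. The strict gap `δ` then pays for it: scaled by `N
  -- = |W - v| / δ`, it covers the excess over `v` of the a priori payoff bound `W`.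
  rcases hR.eq_or_lt with hR0 | hR0
  · rw [← hR0] at hu hsep0
    simp only [zero_mul, add_zero] at hu hsep0
    set W := ∑ i, p i * |x i| * L with hW
    have hL : 0 ≤ L := hz0.1.1.trans hz0.1.2
    have hδ : 0 < P * 1 + Q * τ - u := by linarith
    set δ := P * 1 + Q * τ - u with hδdef
    set N := |W - v| / δ with hN
    have hN0 : 0 ≤ N := by positivity
    have hNδ : N * δ = |W - v| := by rw [hN]; field_simp
    refine ⟨-Q * N, -P * N, mul_nonneg (by linarith) hN0, fun z hz => ?_⟩
    have h1 : ∑ i, p i * x i * z i ≤ W := by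
      refine Finset.sum_le_sum fun i _ => ?_
      calc p i * x i * z i ≤ p i * |x i| * z i := by
            have := (hz i).1.1
            have := hp i
            gcongr
            exact le_abs_self _
        _ ≤ p i * |x i| * L :=
            mul_le_mul_of_nonneg_left (hz i).1.2 (mul_nonneg (hp i) (abs_nonneg _))
    have h2 := mul_le_mul_of_nonneg_left (hsep0 z hz).le hN0
    have h3 := le_abs_self (W - v)
    rw [hδdef] at hNδ
    linarith
  · refine ⟨-Q / R, -P / R, div_nonneg (by linarith) hR, fun z hz => ?_⟩
    have h1 := (hsep0 z hz).le.trans hu.le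
    rw [← sub_nonneg] at h1 ⊢
    have h2 := div_nonneg h1 hR
    refine h2.trans_eq ?_
    field_simp
    ring

/-- The objective separates over coordinates, so a near-maximiser can be chosen independently for
each `i`. -/
theorem sum_truncConj_le {L lam μ c : ℝ} (hne : (truncDom φ L).Nonempty)
    {p x : ι → ℝ} (hp : ∀ i, 0 ≤ p i) (hp1 : ∑ i, p i = 1)
    (h : ∀ z : ι → ℝ, (∀ i, z i ∈ truncDom φ L) →
      ∑ i, p i * x i * z i - lam * ∑ i, p i * (φ (z i)).toReal - μ * ∑ i, p i * z i ≤ c) :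
    ∑ i, p i * truncConj φ L lam (x i - μ) ≤ c := by
  refine le_of_forall_pos_le_add fun ε hε => ?_
  have hex : ∀ i, ∃ z ∈ truncDom φ L,
      truncConj φ L lam (x i - μ) - ε < z * (x i - μ) - lam * (φ z).toReal := by
    intro i
    obtain ⟨_, ⟨z, hz, rfl⟩, hlt⟩ := exists_lt_of_lt_csSup (hne.image _)
      (sub_lt_self (truncConj φ L lam (x i - μ)) hε)
    exact ⟨z, hz, hlt⟩
  choose z hz hlt using hex
  calc ∑ i, p i * truncConj φ L lam (x i - μ)
      ≤ ∑ i, (p i * (z i * (x i - μ) - lam * (φ (z i)).toReal) + p i * ε) := by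
        refine Finset.sum_le_sum fun i _ => ?_
        rw [← mul_add]
        exact mul_le_mul_of_nonneg_left (by linarith [hlt i]) (hp i)
    _ = (∑ i, p i * x i * z i - lam * ∑ i, p i * (φ (z i)).toReal - μ * ∑ i, p i * z i)
        + (∑ i, p i) * ε := by
        rw [Finset.mul_sum, Finset.mul_sum, Finset.sum_mul, ← Finset.sum_sub_distrib,
          ← Finset.sum_sub_distrib, ← Finset.sum_add_distrib]
        exact Finset.sum_congr rfl fun i _ => by ring
    _ ≤ c + ε := by rw [hp1, one_mul]; linarith [h z hz]

theorem finite_duality (hφc : ConvexOn ℝ≥0 Set.univ φ) (hφl : LowerSemicontinuous φ)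
    {L τ v η : ℝ} (hτ : 0 ≤ τ) (hη : 0 < η) (hne : (truncDom φ L).Nonempty) {p x : ι → ℝ}
    (hp : ∀ i, 0 ≤ p i) (hp1 : ∑ i, p i = 1)
    (h : ∀ z : ι → ℝ, (∀ i, z i ∈ Set.Icc 0 L) → ∑ i, p i * z i = 1 →
      sumDiv φ p z ≤ ENNReal.ofReal τ → ∑ i, p i * x i * z i < v) :
    ∃ lam μ : ℝ, 0 < lam ∧
      lam * τ + μ + ∑ i, p i * truncConj φ L lam (x i - μ) ≤ v + η := by
  obtain ⟨lam, μ, hlam, hle⟩ := exists_multipliers hφc hφl hne hp h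
  have h1 := sum_truncConj_le hne hp hp1 hle
  -- Separation only gives `lam ≥ 0`; adding `κ` makes it positive and costs at most `κ * τ ≤ η`.
  set κ := η / (τ + 1) with hκ
  have hκ0 : 0 < κ := by positivity
  have hκτ : κ * τ ≤ η := by
    rw [hκ, div_mul_eq_mul_div, div_le_iff₀ (by positivity)]
    nlinarith
  refine ⟨lam + κ, μ, by positivity, ?_⟩
  have h2 : ∑ i, p i * truncConj φ L (lam + κ) (x i - μ)
      ≤ ∑ i, p i * truncConj φ L lam (x i - μ) :=
    Finset.sum_le_sum fun i _ => mul_le_mul_of_nonneg_left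
      (truncConj_anti hne hlam (by linarith) _) (hp i)
  linarith

end FiniteDuality

/-! ### Weak and strong duality on a general probability space. -/

section Duality

variable {Ω : Type*} [MeasurableSpace Ω] {P : Measure Ω} {φ : ℝ → ℝ≥0∞} {τ : ℝ}

theorem ae_ne_top_of_mem_ambiguitySet (hφl : LowerSemicontinuous φ) {ζ : Ω → ℝ}
    (hζ : ζ ∈ ambiguitySet P φ τ) : ∀ᵐ ω ∂P, φ (ζ ω) ≠ ⊤ := by
  have h := ae_lt_top (hφl.measurable.comp hζ.1.1) (hζ.2.trans_lt ENNReal.ofReal_lt_top).ne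
  filter_upwards [h] with ω hω using hω.ne

theorem integrable_divergence (hφl : LowerSemicontinuous φ) {ζ : Ω → ℝ}
    (hζ : ζ ∈ ambiguitySet P φ τ) : Integrable (fun ω => (φ (ζ ω)).toReal) P :=
  integrable_toReal_of_lintegral_ne_top (hφl.measurable.comp hζ.1.1).aemeasurable
    (hζ.2.trans_lt ENNReal.ofReal_lt_top).ne

theorem integral_divergence_le (hφl : LowerSemicontinuous φ) (hτ : 0 ≤ τ) {ζ : Ω → ℝ}
    (hζ : ζ ∈ ambiguitySet P φ τ) : ∫ ω, (φ (ζ ω)).toReal ∂P ≤ τ := by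
  have hm := hφl.measurable.comp hζ.1.1
  rw [integral_toReal (f := fun ω => φ (ζ ω)) hm.aemeasurable
    (ae_lt_top hm (hζ.2.trans_lt ENNReal.ofReal_lt_top).ne)]
  exact ENNReal.toReal_le_of_le_ofReal hτ hζ.2

theorem integrable_mul_of_mem_Icc {B : ℝ} {X ζ : Ω → ℝ} (hX : Measurable X)
    (hXB : ∀ ω, X ω ∈ Set.Icc 0 B) (hζ : Integrable ζ P) :
    Integrable (fun ω => X ω * ζ ω) P :=
  hζ.bdd_mul (c := B) hX.aestronglyMeasurable (ae_of_all _ fun ω => by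
    rw [Real.norm_eq_abs, abs_of_nonneg (hXB ω).1]
    exact (hXB ω).2)

variable [IsProbabilityMeasure P] {L lam μ : ℝ}

theorem integrable_truncConj (hne : (truncDom φ L).Nonempty) (hlam : 0 ≤ lam) {B : ℝ}
    {X : Ω → ℝ} (hX : Measurable X) (hXB : ∀ ω, X ω ∈ Set.Icc 0 B) :
    Integrable (fun ω => truncConj φ L lam (X ω - μ)) P := by
  have hL : 0 ≤ L := by
    obtain ⟨z, hz⟩ := hne
    exact hz.1.1.trans hz.1.2
  refine Integrable.of_bound (C := |truncConj φ L lam (0 - μ)| + L * B)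
    ((continuous_truncConj hne hlam).measurable.comp
      (hX.sub measurable_const)).aestronglyMeasurable (ae_of_all _ fun ω => ?_)
  have h1 := abs_truncConj_sub_le hne hlam (X ω - μ) (0 - μ)
  rw [sub_sub_sub_cancel_right, sub_zero, abs_of_nonneg (hXB ω).1] at h1
  have h2 := mul_le_mul_of_nonneg_left (hXB ω).2 hL
  have h3 := abs_sub_abs_le_abs_sub (truncConj φ L lam (X ω - μ)) (truncConj φ L lam (0 - μ))
  rw [Real.norm_eq_abs]
  linarith

/-- Fenchel–Young, integrated pointwise against the mass and divergence constraints. -/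
theorem integral_mul_le_dual (hφl : LowerSemicontinuous φ) (hτ : 0 ≤ τ) (hlam : 0 ≤ lam)
    {B : ℝ} {X : Ω → ℝ} (hX : Measurable X) (hXB : ∀ ω, X ω ∈ Set.Icc 0 B)
    (hne : (truncDom φ L).Nonempty) {ζ : Ω → ℝ}
    (hζ : ζ ∈ ambiguitySet P φ τ) (hζL : ∀ ω, ζ ω ≤ L) :
    ∫ ω, X ω * ζ ω ∂P ≤ lam * τ + μ + ∫ ω, truncConj φ L lam (X ω - μ) ∂P := by
  have hF := integrable_divergence hφl hζ
  have hFτ := integral_divergence_le hφl hτ hζ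
  have hXζ := integrable_mul_of_mem_Icc hX hXB hζ.1.2.2.1
  have hμζ := hζ.1.2.2.1.const_mul μ
  have hsub : Integrable (fun ω => X ω * ζ ω - μ * ζ ω) P := hXζ.sub hμζ
  have h1 : ∫ ω, (X ω * ζ ω - μ * ζ ω - lam * (φ (ζ ω)).toReal) ∂P
      ≤ ∫ ω, truncConj φ L lam (X ω - μ) ∂P := by
    refine integral_mono_ae (hsub.sub (hF.const_mul lam))
      (integrable_truncConj hne hlam hX hXB) ?_
    filter_upwards [ae_ne_top_of_mem_ambiguitySet hφl hζ] with ω hω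
    have := le_truncConj hlam (X ω - μ) (z := ζ ω) ⟨⟨hζ.1.2.1 ω, hζL ω⟩, hω⟩
    linarith
  rw [integral_sub hsub (hF.const_mul lam), integral_sub hXζ hμζ, integral_const_mul,
    integral_const_mul, hζ.1.2.2.2] at h1
  have h2 := mul_le_mul_of_nonneg_left hFτ hlam
  linarith

theorem integral_dualIntegrand_truncate (hne : (truncDom φ L).Nonempty) {B : ℝ}
    {X : Ω → ℝ} (hX : Measurable X) (hXB : ∀ ω, X ω ∈ Set.Icc 0 B) {θ : ℝ × ℝ}
    (hθ : θ ∈ dualParams) :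
    ∫ ω, (dualIntegrand (truncate φ L) τ θ (X ω)).toReal ∂P
      = θ.1 * τ + θ.2 + ∫ ω, truncConj φ L θ.1 (X ω - θ.2) ∂P := by
  have h : ∀ ω, (dualIntegrand (truncate φ L) τ θ (X ω)).toReal
      = θ.1 * τ + θ.2 + truncConj φ L θ.1 (X ω - θ.2) := fun ω => by
    rw [dualIntegrand_truncate hne τ hθ, EReal.toReal_coe]
  simp_rw [h]
  rw [integral_add (integrable_const _) (integrable_truncConj hne (le_of_lt hθ) hX hXB)]
  simp

/-- Weak duality for densities bounded by `L`. -/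
theorem integral_mul_le_dualRisk (hφl : LowerSemicontinuous φ) (hτ : 0 ≤ τ)
    {B : ℝ} {X : Ω → ℝ} (hX : Measurable X) (hXB : ∀ ω, X ω ∈ Set.Icc 0 B)
    (hne : (truncDom φ L).Nonempty) {ζ : Ω → ℝ}
    (hζ : ζ ∈ ambiguitySet P φ τ) (hζL : ∀ ω, ζ ω ≤ L) :
    ((∫ ω, X ω * ζ ω ∂P : ℝ) : EReal) ≤ dualRisk P (truncate φ L) τ X := by
  refine le_iInf₂ fun θ hθ => ?_
  rw [integral_dualIntegrand_truncate hne hX hXB hθ]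
  exact EReal.coe_le_coe_iff.2 (integral_mul_le_dual hφl hτ (le_of_lt hθ) hX hXB hne hζ hζL)

theorem integral_comp_fintype {ι : Type*} [Fintype ι] [MeasurableSpace ι]
    [MeasurableSingletonClass ι] {k : Ω → ι} (hk : Measurable k) (g : ι → ℝ) :
    ∫ ω, g (k ω) ∂P = ∑ i, (P.map k).real {i} * g i := by
  have : IsProbabilityMeasure (P.map k) := Measure.isProbabilityMeasure_map hk.aemeasurable
  rw [← integral_map (f := g) hk.aemeasurable (Measurable.of_discrete).aestronglyMeasurable,
    integral_fintype Integrable.of_finite]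
  rfl

theorem comp_mem_ambiguitySet {ι : Type*} [Fintype ι] [MeasurableSpace ι]
    [MeasurableSingletonClass ι] {k : Ω → ι} (hk : Measurable k) {z : ι → ℝ}
    (hz : ∀ i, 0 ≤ z i) (hz1 : ∑ i, (P.map k).real {i} * z i = 1)
    (hzτ : sumDiv φ (fun i => (P.map k).real {i}) z ≤ ENNReal.ofReal τ) :
    (fun ω => z (k ω)) ∈ ambiguitySet P φ τ := by
  have : IsProbabilityMeasure (P.map k) := Measure.isProbabilityMeasure_map hk.aemeasurable
  have hint : Integrable z (P.map k) := Integrable.of_finite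
  refine ⟨⟨Measurable.of_discrete.comp hk, fun ω => hz _, hint.comp_measurable hk, ?_⟩, ?_⟩
  · rw [integral_comp_fintype hk, hz1]
  · rw [← lintegral_map (f := fun i => φ (z i)) Measurable.of_discrete hk, lintegral_fintype]
    refine le_trans (le_of_eq (Finset.sum_congr rfl fun i _ => ?_)) hzτ
    rw [ofReal_measureReal, mul_comm]

/-- `X` is rounded down to multiples of `δ`. Rounding down keeps every discrete payoff below `v`,
and returning to `X` in the conjugate costs `L * δ`. -/
theorem dual_le_of_discretization (hφc : ConvexOn ℝ≥0 Set.univ φ) (hφl : LowerSemicontinuous φ)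
    (hτ : 0 ≤ τ) {B : ℝ} {X : Ω → ℝ} (hX : Measurable X) (hXB : ∀ ω, X ω ∈ Set.Icc 0 B)
    (hne : (truncDom φ L).Nonempty) {v δ η : ℝ} (hδ : 0 < δ) (hη : 0 < η)
    (h : ∀ ζ ∈ ambiguitySet P φ τ, ∫ ω, X ω * ζ ω ∂P < v) :
    ∃ lam μ : ℝ, 0 < lam ∧
      lam * τ + μ + ∫ ω, truncConj φ L lam (X ω - μ) ∂P ≤ v + η + L * δ := by
  have hL : 0 ≤ L := by
    obtain ⟨z, hz⟩ := hne
    exact hz.1.1.trans hz.1.2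
  have hlt : ∀ ω, ⌊X ω / δ⌋₊ < ⌊B / δ⌋₊ + 1 := fun ω =>
    Nat.lt_succ_of_le (Nat.floor_le_floor (by have := (hXB ω).2; gcongr))
  let k : Ω → Fin (⌊B / δ⌋₊ + 1) := fun ω => ⟨⌊X ω / δ⌋₊, hlt ω⟩
  have hk : Measurable k := by
    refine measurable_to_countable' fun i => ?_
    have : k ⁻¹' {i} = (fun ω => ⌊X ω / δ⌋₊) ⁻¹' {(i : ℕ)} := by
      ext ω
      simp [k, Fin.ext_iff]
    rw [this]
    exact (Nat.measurable_floor.comp (hX.div_const δ)) (measurableSet_singleton _)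
  let x : Fin (⌊B / δ⌋₊ + 1) → ℝ := fun i => δ * (i : ℕ)
  have hx0 : ∀ ω, x (k ω) ≤ X ω := fun ω => by
    have := Nat.floor_le (div_nonneg (hXB ω).1 hδ.le)
    rw [le_div_iff₀' hδ] at this
    exact this
  have hx1 : ∀ ω, X ω ≤ x (k ω) + δ := fun ω => by
    have := (Nat.lt_floor_add_one (X ω / δ)).le
    rw [div_le_iff₀' hδ, mul_add, mul_one] at this
    exact this
  have hprob : IsProbabilityMeasure (P.map k) := Measure.isProbabilityMeasure_map hk.aemeasurable
  have hp1 : ∑ i, (P.map k).real {i} = 1 := by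
    simp
  obtain ⟨lam, μ, hlam, hle⟩ := finite_duality (L := L) (v := v) (p := fun i => (P.map k).real {i})
    (x := x) hφc hφl hτ hη hne (fun i => measureReal_nonneg) hp1 (by
      intro z hz hz1 hzτ
      have hmem := comp_mem_ambiguitySet hk (fun i => (hz i).1) hz1 hzτ
      refine lt_of_le_of_lt ?_ (h _ hmem)
      simp_rw [mul_assoc]
      rw [← integral_comp_fintype hk (fun i => x i * z i)]
      refine integral_mono
        (Integrable.comp_measurable (g := fun i => x i * z i) Integrable.of_finite hk)
        (integrable_mul_of_mem_Icc hX hXB hmem.1.2.2.1) fun ω => ?_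
      exact mul_le_mul_of_nonneg_right (hx0 ω) (hz _).1)
  refine ⟨lam, μ, hlam, ?_⟩
  have hint : Integrable (fun ω => truncConj φ L lam (x (k ω) - μ)) P :=
    Integrable.comp_measurable (g := fun i => truncConj φ L lam (x i - μ)) Integrable.of_finite hk
  have h1 : ∫ ω, truncConj φ L lam (X ω - μ) ∂P
      ≤ ∫ ω, (truncConj φ L lam (x (k ω) - μ) + L * δ) ∂P := by
    refine integral_mono (integrable_truncConj hne hlam.le hX hXB)
      (hint.add (integrable_const _)) fun ω => ?_
    have h2 := truncConj_le_add hne hlam.le (X ω - μ) (x (k ω) - μ)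
    rw [sub_sub_sub_cancel_right, abs_of_nonneg (sub_nonneg.2 (hx0 ω))] at h2
    have h3 : L * (X ω - x (k ω)) ≤ L * δ :=
      mul_le_mul_of_nonneg_left (by linarith [hx1 ω]) hL
    simp only
    linarith
  rw [integral_add hint (integrable_const _),
    integral_comp_fintype hk (fun i => truncConj φ L lam (x i - μ))] at h1
  simp only [integral_const, probReal_univ, one_smul] at h1
  linarith

/-- The nontrivial half of strong duality. -/
theorem dualRisk_truncate_le_robustRisk (hφc : ConvexOn ℝ≥0 Set.univ φ)
    (hφl : LowerSemicontinuous φ) (hτ : 0 ≤ τ) {B : ℝ} {X : Ω → ℝ} (hX : Measurable X)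
    (hXB : ∀ ω, X ω ∈ Set.Icc 0 B) (hne : (truncDom φ L).Nonempty) :
    dualRisk P (truncate φ L) τ X ≤ robustRisk P φ τ X := by
  have hL : 0 ≤ L := by
    obtain ⟨z, hz⟩ := hne
    exact hz.1.1.trans hz.1.2
  rw [← EReal.le_of_forall_lt_iff_le]
  intro v hv
  -- A second real `v' > v` provides room, split equally between `η` and the rounding error;
  -- dividing by `L + 1` also covers `L = 0`.
  rw [← EReal.le_of_forall_lt_iff_le]
  intro v' hv'
  have hvv : 0 < v' - v := sub_pos.2 (EReal.coe_lt_coe_iff.1 hv')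
  have h : ∀ ζ ∈ ambiguitySet P φ τ, ∫ ω, X ω * ζ ω ∂P < v := fun ζ hζ =>
    EReal.coe_lt_coe_iff.1 (lt_of_le_of_lt
      (le_iSup₂ (f := fun ζ (_ : ζ ∈ ambiguitySet P φ τ) =>
        ((∫ ω, X ω * ζ ω ∂P : ℝ) : EReal)) ζ hζ) hv)
  obtain ⟨lam, μ, hlam, hle⟩ := dual_le_of_discretization (L := L)
    (δ := (v' - v) / 2 / (L + 1)) (η := (v' - v) / 2) hφc hφl hτ hX hXB hne
    (by positivity) (by positivity) h
  have hθ : (lam, μ) ∈ dualParams := hlam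
  refine (iInf₂_le (lam, μ) hθ).trans ?_
  rw [integral_dualIntegrand_truncate hne hX hXB hθ]
  refine EReal.coe_le_coe_iff.2 (hle.trans ?_)
  have h1 : L * ((v' - v) / 2 / (L + 1)) ≤ (v' - v) / 2 := by
    rw [← mul_div_assoc, div_le_iff₀ (by positivity)]
    nlinarith
  linarith

end Duality

/-! ### Replacing feasible densities by bounded ones. -/

section Truncation

variable {Ω : Type*} [MeasurableSpace Ω] {P : Measure Ω} {φ : ℝ → ℝ≥0∞} {τ : ℝ}

theorem integrable_weight_mul {w : Ω → ℝ≥0} (hw : Measurable w) (hw1 : ∀ ω, w ω ≤ 1)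
    {g : Ω → ℝ} (hg : Integrable g P) : Integrable (fun ω => (w ω : ℝ) * g ω) P :=
  integrable_mul_of_mem_Icc (B := 1) hw.coe_nnreal_real
    (fun ω => ⟨(w ω).coe_nonneg, by exact_mod_cast hw1 ω⟩) hg

theorem exists_tail_integral_le {ζ : Ω → ℝ} (hζ : Measurable ζ) (hi : Integrable ζ P) {e : ℝ}
    (he : 0 < e) : ∃ K : ℝ, ∫ ω in {ω | K < ζ ω}, ζ ω ∂P ≤ e := by
  have h := tendsto_setIntegral_of_antitone (μ := P) (f := ζ)
    (s := fun n : ℕ => {ω | (n : ℝ) < ζ ω})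
    (fun n => measurableSet_lt measurable_const hζ)
    (fun m n hmn ω (hω : (n : ℝ) < ζ ω) => lt_of_le_of_lt (Nat.cast_le.2 hmn : (m : ℝ) ≤ n) hω) ⟨0, hi.integrableOn⟩
  have hempty : ⋂ n : ℕ, {ω | (n : ℝ) < ζ ω} = ∅ := by
    ext ω
    simp only [Set.mem_iInter, Set.mem_ofPred_eq, Set.mem_empty_iff_false, iff_false, not_forall,
      not_lt]
    exact exists_nat_ge (ζ ω)
  rw [hempty, setIntegral_empty] at h
  obtain ⟨n, hn⟩ := (h.eventually (gt_mem_nhds he)).exists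
  exact ⟨n, hn.le⟩

/-- Above `K` the divergence dominates `N * ζ`, and its integral is at most `τ`; the bound does not
depend on `ζ` or `P`. -/
theorem tail_integral_le (hφl : LowerSemicontinuous φ) (hτ : 0 ≤ τ) {N K : ℝ} (hN : 0 < N)
    (hK : ∀ x, K < x → φ x ≠ ⊤ → N * x ≤ (φ x).toReal) {ζ : Ω → ℝ}
    (hζ : ζ ∈ ambiguitySet P φ τ) : ∫ ω in {ω | K < ζ ω}, ζ ω ∂P ≤ τ / N := by
  have hA : MeasurableSet {ω | K < ζ ω} := measurableSet_lt measurable_const hζ.1.1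
  have hF := integrable_divergence hφl hζ
  rw [le_div_iff₀' hN, ← integral_indicator hA, ← integral_const_mul]
  refine le_trans (integral_mono_ae ((hζ.1.2.2.1.indicator hA).const_mul N) hF ?_)
    (integral_divergence_le hφl hτ hζ)
  filter_upwards [ae_ne_top_of_mem_ambiguitySet hφl hζ] with ω hω
  by_cases h : K < ζ ω
  · rw [Set.indicator_of_mem (by exact h)]
    exact hK _ h hω
  · rw [Set.indicator_of_notMem (by exact h), mul_zero]
    exact ENNReal.toReal_nonneg

variable [IsProbabilityMeasure P]

/-- Jensen's inequality with respect to the weight `w`. -/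
theorem apply_weighted_average_le (hφc : ConvexOn ℝ≥0 Set.univ φ) (hφl : LowerSemicontinuous φ)
    {ζ : Ω → ℝ} (hζ : ζ ∈ ambiguitySet P φ τ) {w : Ω → ℝ≥0} (hw : Measurable w)
    (hw1 : ∀ ω, w ω ≤ 1) (hm : 0 < ∫ ω, (w ω : ℝ) ∂P) :
    φ ((∫ ω, (w ω : ℝ) ∂P)⁻¹ * ∫ ω, w ω * ζ ω ∂P)
      ≤ ENNReal.ofReal ((∫ ω, (w ω : ℝ) ∂P)⁻¹ * ∫ ω, w ω * (φ (ζ ω)).toReal ∂P) := by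
  set Q := P.withDensity fun ω => (w ω : ℝ≥0∞) with hQ
  have hQP : Q ≤ P := by
    calc Q ≤ P.withDensity 1 := withDensity_mono (ae_of_all _ fun ω => by
          simpa using hw1 ω)
      _ = P := withDensity_one
  have hfin : IsFiniteMeasure Q := isFiniteMeasure_of_le P hQP
  have hint : ∀ g : Ω → ℝ, ∫ ω, g ω ∂Q = ∫ ω, w ω * g ω ∂P := fun g => by
    rw [hQ, integral_withDensity_eq_integral_smul hw]
    rfl
  have hmass : Q.real Set.univ = ∫ ω, (w ω : ℝ) ∂P := by
    have := hint fun _ => 1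
    simpa using this
  have hne : NeZero Q := ⟨fun h => by
    rw [h] at hmass
    simp only [measureReal_zero, Pi.zero_apply] at hmass
    linarith⟩
  have hζi : Integrable ζ Q := hζ.1.2.2.1.mono_measure hQP
  have hFi : Integrable (fun ω => (φ (ζ ω)).toReal) Q :=
    (integrable_divergence hφl hζ).mono_measure hQP
  -- The `Q`-average of the points `(ζ, φ(ζ))` stays in the closed convex epigraph, which is
  -- Jensen's inequality.
  have h := Convex.average_mem (μ := Q) (f := fun ω => (ζ ω, (φ (ζ ω)).toReal))
    (convex_epigraph (apply_combination_le hφc)) (isClosed_epigraph hφl)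
    (by
      have hac : ∀ᵐ ω ∂Q, φ (ζ ω) ≠ ⊤ := hQP.absolutelyContinuous.ae_le
        (ae_ne_top_of_mem_ambiguitySet hφl hζ)
      filter_upwards [hac] with ω hω
      exact ⟨ENNReal.toReal_nonneg, (ENNReal.ofReal_toReal hω).ge⟩)
    (hζi.prodMk hFi)
  rw [average_eq, integral_pair hζi hFi, hint, hint, hmass] at h
  exact h.2

/-- Mixing a density with its weighted average along a weight `w` stays in the ambiguity set. -/
theorem mixed_mem_ambiguitySet (hφc : ConvexOn ℝ≥0 Set.univ φ) (hφl : LowerSemicontinuous φ)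
    (hτ : 0 ≤ τ) {ζ : Ω → ℝ} (hζ : ζ ∈ ambiguitySet P φ τ) {w : Ω → ℝ≥0} (hw : Measurable w)
    (hw1 : ∀ ω, w ω ≤ 1) (hm : 0 < ∫ ω, (w ω : ℝ) ∂P) {c : ℝ}
    (hc : c = (∫ ω, (w ω : ℝ) ∂P)⁻¹ * ∫ ω, w ω * ζ ω ∂P) :
    (fun ω => (1 - w ω) * ζ ω + w ω * c) ∈ ambiguitySet P φ τ := by
  have hJ := apply_weighted_average_le hφc hφl hζ hw hw1 hm
  rw [← hc] at hJ
  set m := ∫ ω, (w ω : ℝ) ∂P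
  have hw1' : ∀ ω, (w ω : ℝ) ≤ 1 := fun ω => by exact_mod_cast hw1 ω
  have hwi : Integrable (fun ω => (w ω : ℝ)) P := by
    simpa using integrable_weight_mul hw hw1 (integrable_const (μ := P) (1 : ℝ))
  have hmix : ∀ g : Ω → ℝ, Integrable g P → ∀ d : ℝ,
      Integrable (fun ω => (1 - w ω) * g ω + w ω * d) P ∧
      ∫ ω, ((1 - w ω) * g ω + w ω * d) ∂P
        = ∫ ω, g ω ∂P - ∫ ω, w ω * g ω ∂P + m * d := by
    intro g hg d
    have hwg := integrable_weight_mul hw hw1 hg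
    have heq : (fun ω => (1 - (w ω : ℝ)) * g ω + w ω * d)
        = fun ω => g ω - w ω * g ω + w ω * d := by
      ext ω
      ring
    have hsub : Integrable (fun ω => g ω - w ω * g ω) P := hg.sub hwg
    rw [heq]
    refine ⟨hsub.add (hwi.mul_const d), ?_⟩
    rw [integral_add hsub (hwi.mul_const d), integral_sub hg hwg, integral_mul_const]
  have hs0 : 0 ≤ ∫ ω, w ω * ζ ω ∂P :=
    integral_nonneg fun ω => mul_nonneg (w ω).coe_nonneg (hζ.1.2.1 ω)
  have hc0 : 0 ≤ c := by
    rw [hc]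
    positivity
  refine ⟨⟨?_, fun ω => ?_, (hmix ζ hζ.1.2.2.1 c).1, ?_⟩, ?_⟩
  · exact ((measurable_const.sub hw.coe_nnreal_real).mul hζ.1.1).add
      (hw.coe_nnreal_real.mul_const c)
  · exact add_nonneg (mul_nonneg (sub_nonneg.2 (hw1' ω)) (hζ.1.2.1 ω)) (mul_nonneg (w ω).coe_nonneg hc0)
  · rw [(hmix ζ hζ.1.2.2.1 c).2, hζ.1.2.2.2, hc, mul_inv_cancel_left₀ hm.ne']
    ring
  · have hF := integrable_divergence hφl hζ
    have hFτ := integral_divergence_le hφl hτ hζ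
    have hcT : φ c ≠ ⊤ := (hJ.trans_lt ENNReal.ofReal_lt_top).ne
    obtain ⟨hGi, hGe⟩ := hmix _ hF (φ c).toReal
    have hle : ∀ᵐ ω ∂P, φ ((1 - w ω) * ζ ω + w ω * c)
        ≤ ENNReal.ofReal ((1 - w ω) * (φ (ζ ω)).toReal + w ω * (φ c).toReal) := by
      filter_upwards [ae_ne_top_of_mem_ambiguitySet hφl hζ] with ω hω
      have h1 : 0 ≤ 1 - (w ω : ℝ) := sub_nonneg.2 (hw1' ω)
      have h2 := apply_combination_le hφc (ζ ω) c _ _ h1 (w ω).coe_nonneg (sub_add_cancel _ _)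
      rw [ENNReal.ofReal_add (mul_nonneg h1 ENNReal.toReal_nonneg)
        (mul_nonneg (w ω).coe_nonneg ENNReal.toReal_nonneg), ENNReal.ofReal_mul h1,
        ENNReal.ofReal_mul (w ω).coe_nonneg, ENNReal.ofReal_toReal hω, ENNReal.ofReal_toReal hcT]
      exact h2
    refine (lintegral_mono_ae hle).trans ?_
    rw [← ofReal_integral_eq_lintegral_ofReal hGi (ae_of_all _ fun ω =>
      add_nonneg (mul_nonneg (sub_nonneg.2 (hw1' ω)) ENNReal.toReal_nonneg)
        (mul_nonneg (w ω).coe_nonneg ENNReal.toReal_nonneg)), hGe]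
    refine ENNReal.ofReal_le_ofReal ?_
    have hn : 0 ≤ m⁻¹ * ∫ ω, w ω * (φ (ζ ω)).toReal ∂P :=
      mul_nonneg (inv_nonneg.2 hm.le)
        (integral_nonneg fun ω => mul_nonneg (w ω).coe_nonneg ENNReal.toReal_nonneg)
    -- Jensen gives `m * φ(c) ≤ ∫ w φ(ζ)`: the divergence added through `c` is at most the
    -- divergence removed.
    have h3 := mul_le_mul_of_nonneg_left (ENNReal.toReal_le_of_le_ofReal hn hJ) hm.le
    rw [mul_inv_cancel_left₀ hm.ne'] at h3
    linarith

/-- A density of the ambiguity set can be replaced by one bounded by `max K t⁻¹`, at a cost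
controlled by its tail above `K`. -/
theorem exists_bounded_mem_ambiguitySet (hφc : ConvexOn ℝ≥0 Set.univ φ)
    (hφl : LowerSemicontinuous φ) (hτ : 0 ≤ τ) {B : ℝ} (hB : 0 ≤ B) {X : Ω → ℝ}
    (hX : Measurable X) (hXB : ∀ ω, X ω ∈ Set.Icc 0 B) {ζ : Ω → ℝ}
    (hζ : ζ ∈ ambiguitySet P φ τ) (K : ℝ) {t : ℝ} (ht : 0 < t) (ht1 : t ≤ 1) :
    ∃ ζ' ∈ ambiguitySet P φ τ, (∀ ω, ζ' ω ≤ max K t⁻¹) ∧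
      ∫ ω, X ω * ζ ω ∂P ≤ ∫ ω, X ω * ζ' ω ∂P + B * (∫ ω in {ω | K < ζ ω}, ζ ω ∂P + t) := by
  classical
  have hA : MeasurableSet {ω | K < ζ ω} := measurableSet_lt measurable_const hζ.1.1
  -- Weight `1` averages the tail out entirely; weight `t` elsewhere keeps the total weight at least
  -- `t`, so that the average `c` is at most `t⁻¹`.
  let w : Ω → ℝ≥0 := fun ω => if K < ζ ω then 1 else t.toNNReal
  have hw : Measurable w := Measurable.ite hA measurable_const measurable_const
  have hwA : ∀ ω, K < ζ ω → (w ω : ℝ) = 1 := fun ω h => by simp [w, h]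
  have hwA' : ∀ ω, ¬ K < ζ ω → (w ω : ℝ) = t := fun ω h => by simp [w, h, ht.le]
  have htw : ∀ ω, t ≤ w ω := fun ω => by
    by_cases h : K < ζ ω
    · rw [hwA ω h]; exact ht1
    · rw [hwA' ω h]
  have hw1' : ∀ ω, (w ω : ℝ) ≤ 1 := fun ω => by
    by_cases h : K < ζ ω
    · rw [hwA ω h]
    · rw [hwA' ω h]; exact ht1
  have hw1 : ∀ ω, w ω ≤ 1 := fun ω => by exact_mod_cast hw1' ω
  have hζi := hζ.1.2.2.1
  have hζ0 := hζ.1.2.1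
  have hwi : Integrable (fun ω => (w ω : ℝ)) P := by
    simpa using integrable_weight_mul hw hw1 (integrable_const (μ := P) (1 : ℝ))
  have hwζ := integrable_weight_mul hw hw1 hζi
  have hm : t ≤ ∫ ω, (w ω : ℝ) ∂P := by
    have := integral_mono (integrable_const (μ := P) t) hwi htw
    simpa using this
  have hm0 := ht.trans_le hm
  have hs1 : ∫ ω, w ω * ζ ω ∂P ≤ 1 := by
    rw [← hζ.1.2.2.2]
    exact integral_mono hwζ hζi fun ω => mul_le_of_le_one_left (hζ0 ω) (hw1' ω)
  have hs0 : 0 ≤ ∫ ω, w ω * ζ ω ∂P := integral_nonneg fun ω => mul_nonneg (w ω).coe_nonneg (hζ0 ω)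
  obtain ⟨c, hc⟩ : ∃ c, c = (∫ ω, (w ω : ℝ) ∂P)⁻¹ * ∫ ω, w ω * ζ ω ∂P := ⟨_, rfl⟩
  have hc0 : 0 ≤ c := by
    rw [hc]
    exact mul_nonneg (inv_nonneg.2 hm0.le) hs0
  have hct : c ≤ t⁻¹ := by
    rw [hc]
    calc _ ≤ t⁻¹ * 1 := mul_le_mul (inv_anti₀ ht hm) hs1 hs0 (inv_nonneg.2 ht.le)
      _ = t⁻¹ := mul_one _
  have hmem := mixed_mem_ambiguitySet hφc hφl hτ hζ hw hw1 hm0 hc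
  refine ⟨_, hmem, fun ω => ?_, ?_⟩
  · by_cases h : K < ζ ω
    · rw [hwA ω h]
      simpa using Or.inr hct
    · have h1 : ζ ω ≤ max K t⁻¹ := (not_lt.1 h).trans (le_max_left _ _)
      have h2 : c ≤ max K t⁻¹ := hct.trans (le_max_right _ _)
      have h3 := mul_le_mul_of_nonneg_left h1 (sub_nonneg.2 (hw1' ω))
      have h4 := mul_le_mul_of_nonneg_left h2 (w ω).coe_nonneg
      linarith
  · have hXζ' := integrable_mul_of_mem_Icc hX hXB hmem.1.2.2.1
    -- Only the removed mass `w ζ` can lose payoff, at rate at most `B`; the returned term `w c` is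
    -- nonnegative and is dropped.
    have h1 : ∫ ω, X ω * ζ ω ∂P
        ≤ ∫ ω, (X ω * ((1 - w ω) * ζ ω + w ω * c) + B * (w ω * ζ ω)) ∂P := by
      refine integral_mono (integrable_mul_of_mem_Icc hX hXB hζi)
        (hXζ'.add (hwζ.const_mul B)) fun ω => ?_
      have h2 := mul_le_mul_of_nonneg_right (hXB ω).2 (mul_nonneg (w ω).coe_nonneg (hζ0 ω))
      have h3 := mul_nonneg (hXB ω).1 (mul_nonneg (w ω).coe_nonneg hc0)
      simp only
      linarith
    rw [integral_add hXζ' (hwζ.const_mul B), integral_const_mul] at h1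
    have h4 : ∫ ω, w ω * ζ ω ∂P ≤ ∫ ω in {ω | K < ζ ω}, ζ ω ∂P + t := by
      have h5 : ∫ ω, w ω * ζ ω ∂P
          ≤ ∫ ω, (Set.indicator {ω | K < ζ ω} ζ ω + t * ζ ω) ∂P := by
        refine integral_mono hwζ ((hζi.indicator hA).add (hζi.const_mul t)) fun ω => ?_
        simp only
        by_cases h : K < ζ ω
        · rw [hwA ω h, Set.indicator_of_mem (by exact h)]
          have := mul_nonneg ht.le (hζ0 ω)
          linarith
        · rw [hwA' ω h, Set.indicator_of_notMem (by exact h), zero_add]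
      rw [integral_add (hζi.indicator hA) (hζi.const_mul t), integral_indicator hA,
        integral_const_mul, hζ.1.2.2.2, mul_one] at h5
      exact h5
    have := mul_le_mul_of_nonneg_left h4 hB
    linarith

theorem exists_forall_mul_le (hsup : Tendsto (fun x : ℝ => φ x / ENNReal.ofReal x) atTop (𝓝 ⊤))
    {N : ℝ} (hN : 0 ≤ N) :
    ∃ K : ℝ, ∀ x, K < x → φ x ≠ ⊤ → N * x ≤ (φ x).toReal := by
  have h := hsup.eventually (lt_mem_nhds (ENNReal.ofReal_lt_top (r := N)))
  obtain ⟨K, hK⟩ := (h.and (eventually_gt_atTop 0)).exists_forall_of_atTop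
  refine ⟨K, fun x hx hfin => ?_⟩
  obtain ⟨h1, h0⟩ := hK x hx.le
  have h2 := ENNReal.mul_le_of_le_div h1.le
  rw [← ENNReal.ofReal_mul hN] at h2
  exact (ENNReal.ofReal_le_iff_le_toReal hfin).1 h2

/-- The tail and the weight `t` each cost at most `ε / 2` after multiplication by `B`. -/
theorem integral_mul_le_dualRisk_add (hφc : ConvexOn ℝ≥0 Set.univ φ)
    (hφl : LowerSemicontinuous φ) (hτ : 0 ≤ τ) {B : ℝ} (hB : 0 < B) {X : Ω → ℝ}
    (hX : Measurable X) (hXB : ∀ ω, X ω ∈ Set.Icc 0 B) {L K ε : ℝ} (hε : 0 < ε)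
    (hne : (truncDom φ L).Nonempty) (hL : max K (min 1 (ε / (2 * B)))⁻¹ ≤ L)
    {ζ : Ω → ℝ} (hζ : ζ ∈ ambiguitySet P φ τ)
    (htail : ∫ ω in {ω | K < ζ ω}, ζ ω ∂P ≤ ε / (2 * B)) :
    ((∫ ω, X ω * ζ ω ∂P - ε : ℝ) : EReal) ≤ dualRisk P (truncate φ L) τ X := by
  obtain ⟨ζ', hζ', hbd, hle⟩ := exists_bounded_mem_ambiguitySet hφc hφl hτ hB.le hX hXB hζ K
    (t := min 1 (ε / (2 * B))) (by positivity) (min_le_left _ _)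
  refine le_trans (EReal.coe_le_coe_iff.2 ?_)
    (integral_mul_le_dualRisk hφl hτ hX hXB hne hζ' fun ω => (hbd ω).trans hL)
  have h1 : B * (∫ ω in {ω | K < ζ ω}, ζ ω ∂P + min 1 (ε / (2 * B)))
      ≤ B * (ε / (2 * B) + ε / (2 * B)) := by
    gcongr
    exact min_le_right _ _
  have h2 : B * (ε / (2 * B) + ε / (2 * B)) = ε := by
    field_simp
    ring
  linarith

end Truncation

/-! ### Near-optimal densities and the final assembly. -/

theorem robustRisk_sub_le {Ω : Type*} [MeasurableSpace Ω] {P : Measure Ω} {φ : ℝ → ℝ≥0∞}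
    {τ : ℝ} {X : Ω → ℝ} {ε : ℝ} {d : EReal}
    (h : ∀ ζ ∈ ambiguitySet P φ τ, ((∫ ω, X ω * ζ ω ∂P - ε : ℝ) : EReal) ≤ d) :
    robustRisk P φ τ X - (ε : EReal) ≤ d := by
  rw [EReal.sub_le_iff_le_add (Or.inl (EReal.coe_ne_bot _)) (Or.inl (EReal.coe_ne_top _))]
  refine iSup₂_le fun ζ hζ => ?_
  rw [← EReal.sub_le_iff_le_add (Or.inl (EReal.coe_ne_bot _)) (Or.inl (EReal.coe_ne_top _)),
    ← EReal.coe_sub]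
  exact h ζ hζ

theorem integral_mul_le_of_mem_densities {Ω : Type*} [MeasurableSpace Ω] {P : Measure Ω}
    {B : ℝ} {X ζ : Ω → ℝ} (hX : Measurable X) (hXB : ∀ ω, X ω ∈ Set.Icc 0 B)
    (hζ : ζ ∈ densities P) : ∫ ω, X ω * ζ ω ∂P ≤ B := by
  calc ∫ ω, X ω * ζ ω ∂P ≤ ∫ ω, B * ζ ω ∂P :=
        integral_mono (integrable_mul_of_mem_Icc hX hXB hζ.2.2.1) (hζ.2.2.1.const_mul B)
          fun ω => mul_le_mul_of_nonneg_right (hXB ω).2 (hζ.2.1 ω)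
    _ = B := by rw [integral_const_mul, hζ.2.2.2, mul_one]

/-- Some density of a nonempty ambiguity set is `ε`-optimal. -/
theorem exists_nearly_optimal {Ω : Type*} [MeasurableSpace Ω] {P : Measure Ω} {φ : ℝ → ℝ≥0∞}
    {τ B : ℝ} {X : Ω → ℝ} (hX : Measurable X) (hXB : ∀ ω, X ω ∈ Set.Icc 0 B)
    (hne : (ambiguitySet P φ τ).Nonempty) {ε : ℝ} (hε : 0 < ε) :
    ∃ ζ ∈ ambiguitySet P φ τ, ∀ ζ' ∈ ambiguitySet P φ τ,
      ∫ ω, X ω * ζ' ω ∂P - ε ≤ ∫ ω, X ω * ζ ω ∂P := by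
  have hbdd : BddAbove ((fun ζ : Ω → ℝ => ∫ ω, X ω * ζ ω ∂P) '' ambiguitySet P φ τ) := by
    refine ⟨B, ?_⟩
    rintro _ ⟨ζ, hζ, rfl⟩
    exact integral_mul_le_of_mem_densities hX hXB hζ.1
  obtain ⟨_, ⟨ζ, hζ, rfl⟩, hlt⟩ := exists_lt_of_lt_csSup
    (hne.image fun ζ : Ω → ℝ => ∫ ω, X ω * ζ ω ∂P) (sub_lt_self _ hε)
  refine ⟨ζ, hζ, fun ζ' hζ' => ?_⟩
  have := le_csSup hbdd ⟨ζ', hζ', rfl⟩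
  simp only at this hlt
  linarith

end PhiDRO

theorem mainTheorem10 (φ : ℝ → ℝ≥0∞)
    (hφ_convex : ConvexOn ℝ≥0 Set.univ φ)
    (hφ_lsc : LowerSemicontinuous φ)
    (hφ_neg : ∀ x : ℝ, x < 0 → φ x = ⊤)
    (hφ_proper : ∃ x : ℝ, φ x ≠ ⊤)
    (τ : ℝ) (hτ : 0 ≤ τ) (B : ℝ) (hB : 0 < B) :
    (∀ (Ω : Type u) [MeasurableSpace Ω] (P : Measure Ω) [IsProbabilityMeasure P]
        (X : Ω → ℝ), Measurable X → (∀ ω, X ω ∈ Set.Icc 0 B) →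
      ∀ ε : ℝ, 0 < ε → ∃ L : ℝ, 0 < L ∧ ∃ M : ℝ, 0 < M ∧
        PhiDRO.dualRisk P (PhiDRO.truncate φ L) τ X ≤ PhiDRO.robustRisk P φ τ X ∧
        PhiDRO.robustRisk P φ τ X - (ε : EReal)
          ≤ PhiDRO.dualRisk P (PhiDRO.truncate φ L) τ X ∧
        PhiDRO.ScalingLipschitz PhiDRO.dualParams
          (PhiDRO.dualIntegrand (PhiDRO.truncate φ L) τ) M) ∧
    (Tendsto (fun x : ℝ => φ x / ENNReal.ofReal x) atTop (𝓝 ⊤) →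
      ∀ ε : ℝ, 0 < ε → ∃ L : ℝ, 0 < L ∧ ∃ M : ℝ, 0 < M ∧
        PhiDRO.ScalingLipschitz PhiDRO.dualParams
          (PhiDRO.dualIntegrand (PhiDRO.truncate φ L) τ) M ∧
        ∀ (Ω : Type u) [MeasurableSpace Ω] (P : Measure Ω) [IsProbabilityMeasure P]
          (X : Ω → ℝ), Measurable X → (∀ ω, X ω ∈ Set.Icc 0 B) →
          PhiDRO.dualRisk P (PhiDRO.truncate φ L) τ X ≤ PhiDRO.robustRisk P φ τ X ∧
          PhiDRO.robustRisk P φ τ X - (ε : EReal)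
            ≤ PhiDRO.dualRisk P (PhiDRO.truncate φ L) τ X) := by
  obtain ⟨z, hz⟩ := hφ_proper
  have hz0 : 0 ≤ z := by
    by_contra! h
    exact hz (hφ_neg z h)
  have hlevel : ∀ K t : ℝ, 0 < t →
      ∃ L : ℝ, 0 < L ∧ (PhiDRO.truncDom φ L).Nonempty ∧ max K t⁻¹ ≤ L := fun K t ht =>
    ⟨max z (max K t⁻¹),
      lt_max_of_lt_right (lt_max_of_lt_right (inv_pos.2 ht)),
      ⟨z, ⟨hz0, le_max_left _ _⟩, hz⟩, le_max_right _ _⟩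
  refine ⟨?_, ?_⟩
  · intro Ω _ P _ X hX hXB ε hε
    -- With no feasible density the robust value is `⊥`: the lower bound is vacuous, while strong
    -- duality still applies.
    rcases (PhiDRO.ambiguitySet P φ τ).eq_empty_or_nonempty with hemp | hnon
    · obtain ⟨L, hL, hne, -⟩ := hlevel 0 1 one_pos
      refine ⟨L, hL, L, hL, PhiDRO.dualRisk_truncate_le_robustRisk hφ_convex hφ_lsc hτ hX hXB hne,
        PhiDRO.robustRisk_sub_le fun ζ hζ => ?_,
        PhiDRO.scalingLipschitz_dualIntegrand_truncate hne τ⟩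
      rw [hemp] at hζ
      exact absurd hζ (Set.notMem_empty ζ)
    · obtain ⟨ζ, hζ, hopt⟩ := PhiDRO.exists_nearly_optimal hX hXB hnon (half_pos hε)
      -- Half of `ε` is spent on near-optimality of `ζ`, the other half on truncation.
      obtain ⟨K, hK⟩ := PhiDRO.exists_tail_integral_le hζ.1.1 hζ.1.2.2.1
        (e := ε / 2 / (2 * B)) (by positivity)
      obtain ⟨L, hL, hne, hKL⟩ := hlevel K (min 1 (ε / 2 / (2 * B))) (by positivity)
      refine ⟨L, hL, L, hL, PhiDRO.dualRisk_truncate_le_robustRisk hφ_convex hφ_lsc hτ hX hXB hne,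
        PhiDRO.robustRisk_sub_le fun ζ' hζ' => ?_,
        PhiDRO.scalingLipschitz_dualIntegrand_truncate hne τ⟩
      refine le_trans (EReal.coe_le_coe_iff.2 ?_) (PhiDRO.integral_mul_le_dualRisk_add hφ_convex
        hφ_lsc hτ hB hX hXB (half_pos hε) hne hKL hζ hK)
      linarith [hopt ζ' hζ']
  · intro hsup ε hε
    -- Chosen so that `τ / N ≤ ε / (2 * B)`; `τ + 1` keeps `N` positive when `τ = 0`.
    have hN : 0 < 2 * B * (τ + 1) / ε := by positivity
    obtain ⟨K, hK⟩ := PhiDRO.exists_forall_mul_le hsup hN.le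
    obtain ⟨L, hL, hne, hKL⟩ := hlevel K (min 1 (ε / (2 * B))) (by positivity)
    refine ⟨L, hL, L, hL, PhiDRO.scalingLipschitz_dualIntegrand_truncate hne τ, ?_⟩
    intro Ω _ P _ X hX hXB
    refine ⟨PhiDRO.dualRisk_truncate_le_robustRisk hφ_convex hφ_lsc hτ hX hXB hne,
      PhiDRO.robustRisk_sub_le fun ζ hζ => ?_⟩
    refine PhiDRO.integral_mul_le_dualRisk_add hφ_convex hφ_lsc hτ hB hX hXB hε hne hKL hζ
      ((PhiDRO.tail_integral_le hφ_lsc hτ hN hK hζ).trans ?_)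
    rw [div_div_eq_mul_div, div_le_div_iff₀ (by positivity) (by positivity)]
    nlinarith [mul_pos hB hε]
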